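/- **Theorem (Characteristic Class Mirror Equivalence).** Let $M$ be a compact connected complex manifold (for instance a compact complex algebraic manifold), let $G$ be a compact connected semisimple Lie group with trivial center and Lie algebra $\mathfrak g$, let $\pi\colon P\to M$ be a smooth principal $G$-bundle and let $\omega$ be a $C^3$ principal connection form on $P$. Let $(D,\lambda)$ be a compatible pair: $D\subset TP$ is a $G$-invariant distribution with $D_p\oplus V_p=T_pP$ (where $V_p=\ker d\pi_p$), and $\lambda$ is a $C^1$ one-form on $P$ with values in $\mathfrak g^*$ such that $d\lambda+\operatorname{ad}^*_\omega\wedge\lambda=0$, $D_p=\{v\in T_pP:\langle\lambda(p),\omega(v)\rangle=0\}$ (an identity of covectors on $T_pP$) and $R_g^*\lambda=\operatorname{Ad}^*_{g^{-1}}\lambda$ for all $g\in G$. Then $(D,-\lambda)$ is a compatible pair, and both of the following hold (so that they are, in particular, equivalent). 1. *(Mirror invariance of the Spencer metrics.)* For all fields $u_1,u_2$ of $\operatorname{Sym}^k(\mathfrak g)$-valued $k$-forms on $M$, the metrics $$\langle u_1,u_2\rangle_{A,\lambda}=\int_M\bigl(1+\|\lambda(p)\|^2\bigr)\langle u_1,u_2\rangle_{\mathrm{std}}\,dV,\qquad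 \langle u_1,u_2\rangle_{B,\lambda}=\int_M\bigl(1+\|\Omega_p\|^2\bigr)\langle u_1,u_2\rangle_{\mathrm{std}}\,dV$$ (with $p\in\pi^{-1}(x)$ and $\Omega=d\omega+\tfrac12[\omega\wedge\omega]$) satisfy $\langle u_1,u_2\rangle_{A,-\lambda}=\langle u_1,u_2\rangle_{A,\lambda}$ and $\langle u_1,u_2\rangle_{B,-\lambda}=\langle u_1,u_2\rangle_{B,\lambda}$, for every choice of $G$-invariant norms $\|\cdot\|$, of fibrewise inner products $\langle\cdot,\cdot\rangle_{\mathrm{std}}$ and of a finite measure $dV$ on $M$ that is positive on nonempty open sets. 2. *(Characteristic class equivalence.)* Let $\mathcal G_{\lambda}$ and $\mathcal G_{-\lambda}$ be complex vector bundles on $M$, each isomorphic to the complexified adjoint bundle $P\times_G(\mathfrak g\otimes\mathbb C)$; this condition does not involve the sign of $\lambda$. Then - $c_i(\mathcal G_\lambda)=c_i(\mathcal G_{-\lambda})\in H^{2i}(M,\mathbb Z)$ for all $i$; - $\operatorname{ch}(\mathcal G_\lambda)=\operatorname{ch}(\mathcal G_{-\lambda})\in H^*(M,\mathbb Q)$;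 - $\operatorname{ch}(\operatorname{Sym}^k(\mathcal G_\lambda))=\operatorname{ch}(\operatorname{Sym}^k(\mathcal G_{-\lambda}))$ for all $k\ge 0$; - $\operatorname{ch}(\Omega^k_M\otimes\operatorname{Sym}^k(\mathcal G_\lambda))=\operatorname{ch}(\Omega^k_M\otimes\operatorname{Sym}^k(\mathcal G_{-\lambda}))$ for all $k\ge 0$, where $\Omega^k_M$ is the bundle of holomorphic $k$-forms. -/

import Mathlib

open Bundle Topology
open scoped Manifold ContDiff TensorProduct

universe u v

noncomputable section

/-! ## Singular cohomology -/

namespace SingularCoh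

/-- The standard topological `n`-simplex. -/
abbrev Simplex (n : ℕ) : Type := stdSimplex ℝ (Fin (n + 1))

/-- The affine map `Δ^m → Δ^n` given on vertices by `f`. -/
def simplexMap {m n : ℕ} (f : Fin (m + 1) → Fin (n + 1)) : C(Simplex m, Simplex n) where
  toFun := stdSimplex.map f
  continuous_toFun := stdSimplex.continuous_map f

/-- The `j`-th face inclusion `Δ^n → Δ^(n+1)`, omitting the vertex `j`. -/
def face {n : ℕ} (j : Fin (n + 2)) : C(Simplex n, Simplex (n + 1)) :=
  simplexMap j.succAbove

/-- Singular `n`-cochains of `X` with coefficients in `R`. -/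
abbrev Cochain (X : Type u) [TopologicalSpace X] (R : Type v) (n : ℕ) : Type (max u v) :=
  C(Simplex n, X) → R

variable {X Y : Type u} [TopologicalSpace X] [TopologicalSpace Y] {R : Type v} [CommRing R]

/-- The singular coboundary, `(dφ)(σ) = ∑ⱼ (-1)ʲ φ(σ ∘ δⱼ)`. -/
def coboundary (X : Type u) [TopologicalSpace X] (R : Type v) [CommRing R] (n : ℕ) :
    Cochain X R n →ₗ[R] Cochain X R (n + 1) where
  toFun φ σ := ∑ j : Fin (n + 2), (-1) ^ (j : ℕ) * φ (σ.comp (face j))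
  map_add' φ ψ := by
    funext σ
    simp [mul_add, Finset.sum_add_distrib]
  map_smul' a φ := by
    funext σ
    simp [Finset.mul_sum, mul_left_comm]

/-- Singular `n`-cocycles. -/
def cocycles (X : Type u) [TopologicalSpace X] (R : Type v) [CommRing R] (n : ℕ) :
    Submodule R (Cochain X R n) :=
  LinearMap.ker (coboundary X R n)

/-- Singular `n`-coboundaries (zero for `n = 0`). -/
def coboundaries (X : Type u) [TopologicalSpace X] (R : Type v) [CommRing R] :
    (n : ℕ) → Submodule R (Cochain X R n)
  | 0 => ⊥
  | n + 1 => LinearMap.range (coboundary X R n)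

/-- Singular cohomology `H^n(X; R)`. -/
abbrev H (X : Type u) [TopologicalSpace X] (R : Type v) [CommRing R] (n : ℕ) : Type (max u v) :=
  cocycles X R n ⧸ (coboundaries X R n).submoduleOf (cocycles X R n)

/-- The class of a cocycle. -/
def cls {n : ℕ} (z : Cochain X R n) (hz : z ∈ cocycles X R n) : H X R n :=
  Submodule.Quotient.mk ⟨z, hz⟩

/-- Pull-back of cochains. -/
def cochainPullback (R : Type v) [CommRing R] (f : C(Y, X)) (n : ℕ) :
    Cochain X R n →ₗ[R] Cochain Y R n where
  toFun φ σ := φ (f.comp σ)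
  map_add' _ _ := rfl
  map_smul' _ _ := rfl

theorem cochainPullback_coboundary (f : C(Y, X)) (n : ℕ) (φ : Cochain X R n) :
    cochainPullback R f (n + 1) (coboundary X R n φ) =
      coboundary Y R n (cochainPullback R f n φ) := rfl

/-- Pull-back of cocycles. -/
def cocyclePullback (R : Type v) [CommRing R] (f : C(Y, X)) (n : ℕ) :
    cocycles X R n →ₗ[R] cocycles Y R n :=
  (cochainPullback R f n).restrict (fun φ hφ => by
    have h : coboundary X R n φ = 0 := hφ
    change coboundary Y R n (cochainPullback R f n φ) = 0
    rw [← cochainPullback_coboundary, h, map_zero])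

theorem cochainPullback_mem_coboundaries (f : C(Y, X)) (n : ℕ) (φ : Cochain X R n)
    (hφ : φ ∈ coboundaries X R n) : cochainPullback R f n φ ∈ coboundaries Y R n := by
  cases n with
  | zero =>
    have h : φ = 0 := hφ
    change cochainPullback R f 0 φ = 0
    rw [h, map_zero]
  | succ n =>
    obtain ⟨ψ, rfl⟩ := hφ
    exact ⟨cochainPullback R f n ψ, rfl⟩

/-- Pull-back `f^* : H^n(X; R) → H^n(Y; R)`. -/
def pullback (R : Type v) [CommRing R] (f : C(Y, X)) (n : ℕ) : H X R n →ₗ[R] H Y R n :=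
  Submodule.mapQ _ _ (cocyclePullback R f n)
    (fun φ hφ => cochainPullback_mem_coboundaries f n φ.1 hφ)

/-- The vertex inclusion `{0, 1, 2} → {0, …, 2k}`, `b ↦ 2a + b`. -/
def block (k : ℕ) (a : Fin k) (b : Fin 3) : Fin (2 * k + 1) :=
  ⟨2 * a + b, by omega⟩

/-- The cup product `m₀ ⌣ m₁ ⌣ ⋯ ⌣ m_{k-1}` of 2-cochains (Alexander–Whitney formula): the `a`-th
factor is evaluated on the face spanned by the vertices `2a, 2a+1, 2a+2`. For `k = 0` it is the
unit cochain `1`. -/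
def cupTwo {k : ℕ} (m : Fin k → Cochain X R 2) : Cochain X R (2 * k) :=
  fun σ => ∏ a : Fin k, m a (σ.comp (simplexMap (block k a)))

end SingularCoh

/-! ## Complex vector bundles and their Chern classes -/

/-- A topological complex vector bundle of finite rank over `X`. -/
structure ComplexVectorBundle (X : Type u) [TopologicalSpace X] where
  /-- the model fibre -/
  model : Type u
  [normedModel : NormedAddCommGroup model]
  [spaceModel : NormedSpace ℂ model]
  [finiteModel : FiniteDimensional ℂ model]
  /-- the fibres -/
  fiber : X → Type u
  [addFiber : ∀ x, AddCommGroup (fiber x)]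
  [moduleFiber : ∀ x, Module ℂ (fiber x)]
  [topFiber : ∀ x, TopologicalSpace (fiber x)]
  [topTotal : TopologicalSpace (TotalSpace model fiber)]
  [fiberBundle : FiberBundle model fiber]
  [vectorBundle : VectorBundle ℂ model fiber]

attribute [instance] ComplexVectorBundle.normedModel ComplexVectorBundle.spaceModel
  ComplexVectorBundle.finiteModel ComplexVectorBundle.addFiber ComplexVectorBundle.moduleFiber
  ComplexVectorBundle.topFiber ComplexVectorBundle.topTotal ComplexVectorBundle.fiberBundle
  ComplexVectorBundle.vectorBundle

namespace ComplexVectorBundle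

open SingularCoh

variable {X : Type u} [TopologicalSpace X]

/-- The total space. -/
abbrev Total (E : ComplexVectorBundle X) : Type u := TotalSpace E.model E.fiber

/-- The complex rank. -/
def rank (E : ComplexVectorBundle X) : ℕ := Module.finrank ℂ E.model

/-- A complex line subbundle of the pull-back `f^*E`: a line in every fibre, locally spanned by a
continuous section. -/
structure LineSubbundle (E : ComplexVectorBundle X) {Y : Type u} [TopologicalSpace Y]
    (f : C(Y, X)) where
  /-- the line at a point -/
  line : ∀ y, Submodule ℂ (E.fiber (f y))
  finrank_line : ∀ y, Module.finrank ℂ (line y) = 1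
  local_frame : ∀ y₀, ∃ U ∈ 𝓝 y₀, ∃ s : ∀ y, E.fiber (f y),
    ContinuousOn (fun y => (⟨f y, s y⟩ : E.Total)) U ∧ ∀ y ∈ U, s y ∈ line y ∧ s y ≠ 0

/-- `s` is a continuous nowhere vanishing section of the line bundle `L` along the singular simplex
`σ`. -/
def LineSubbundle.IsFrameAlong {E : ComplexVectorBundle X} {Y : Type u} [TopologicalSpace Y]
    {f : C(Y, X)} (L : LineSubbundle E f) {n : ℕ} (σ : C(Simplex n, Y))
    (s : ∀ t, E.fiber (f (σ t))) : Prop :=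
  Continuous (fun t => (⟨f (σ t), s t⟩ : E.Total)) ∧ ∀ t, s t ∈ L.line (σ t) ∧ s t ≠ 0

/-- `c` is an integral singular 2-cocycle representing the first Chern class of the line bundle `L`:
the obstruction cocycle to a nowhere vanishing section. Choose a nonzero vector over each point,
extend these to frames over all singular 1-simplices; the value on a 2-simplex `σ` is the winding
number, with respect to a frame of `L` along `σ`, of the section so obtained over `∂σ`. -/
def LineSubbundle.IsFirstChernCocycle {E : ComplexVectorBundle X} {Y : Type u} [TopologicalSpace Y]
    {f : C(Y, X)} (L : LineSubbundle E f) (c : Cochain Y ℤ 2) : Prop :=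
  ∃ (s₀ : ∀ y, E.fiber (f y)) (s₁ : ∀ (τ : C(Simplex 1, Y)) (t), E.fiber (f (τ t))),
    (∀ τ, L.IsFrameAlong τ (s₁ τ)) ∧
    (∀ (τ : C(Simplex 1, Y)) (a : Fin 2),
      s₁ τ (stdSimplex.vertex a) = s₀ (τ (stdSimplex.vertex a))) ∧
    ∀ σ : C(Simplex 2, Y), ∃ (s₂ : ∀ t, E.fiber (f (σ t))) (φ : Fin 3 → C(Simplex 1, ℂ)),
      L.IsFrameAlong σ s₂ ∧
      (∀ (j : Fin 3) (t : Simplex 1),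
        s₁ (σ.comp (face j)) t =
          Complex.exp (2 * Real.pi * Complex.I * φ j t) • s₂ (face j t)) ∧
      (c σ : ℂ) = ∑ j : Fin 3, (-1) ^ (j : ℕ) *
        (φ j (stdSimplex.vertex 1) - φ j (stdSimplex.vertex 0))

/-- A splitting of `f^*E` as a direct sum of line bundles `L₁ ⊕ ⋯ ⊕ L_r`. -/
structure Splitting (E : ComplexVectorBundle X) {Y : Type u} [TopologicalSpace Y]
    (f : C(Y, X)) where
  /-- the summands -/
  summand : Fin E.rank → LineSubbundle E f
  isInternal : ∀ y, DirectSum.IsInternal (fun j => (summand j).line y)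

/-- The elementary symmetric polynomial `e_i(c₁, …, c_r)` in 2-cochains, with cup products taken in
increasing order of the indices. -/
def elemSymm {Y : Type u} [TopologicalSpace Y] {R : Type v} [CommRing R] {r : ℕ}
    (c : Fin r → Cochain Y R 2) (i : ℕ) : Cochain Y R (2 * i) :=
  ∑ S : Fin i ↪o Fin r, cupTwo (fun a => c (S a))

/-- The `k`-th component `(1/k!) ∑ⱼ cⱼ^k` of `∑ⱼ exp(cⱼ)` for integral 2-cochains `cⱼ`. -/
def expSum {Y : Type u} [TopologicalSpace Y] {r : ℕ}
    (c : Fin r → Cochain Y ℤ 2) (k : ℕ) : Cochain Y ℚ (2 * k) :=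
  (k.factorial : ℚ)⁻¹ • ∑ j : Fin r, cupTwo (fun _ : Fin k => fun σ => (c j σ : ℚ))

/-- The property characterizing `c_i(E) ∈ H^{2i}(X; ℤ)` (splitting principle): whenever `f^*E` is
a sum of line bundles, `f^*c_i(E)` is the `i`-th elementary symmetric polynomial of their first
Chern classes. -/
def IsChernClass (E : ComplexVectorBundle X) (i : ℕ) (γ : H X ℤ (2 * i)) : Prop :=
  ∀ (Y : Type u) [TopologicalSpace Y] (f : C(Y, X)) (S : E.Splitting f)
    (c : Fin E.rank → Cochain Y ℤ 2), (∀ j, (S.summand j).IsFirstChernCocycle (c j)) →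
      ∃ h : elemSymm c i ∈ cocycles Y ℤ (2 * i), pullback ℤ f (2 * i) γ = cls (elemSymm c i) h

/-- The property characterizing the degree `2k` component of the Chern character (splitting
principle): whenever `f^*E` is a sum of line bundles with first Chern classes `xⱼ`, its pull-back
under `f` is `(1/k!) ∑ⱼ xⱼ^k`. -/
def IsChernCharacter (E : ComplexVectorBundle X) (k : ℕ) (γ : H X ℚ (2 * k)) : Prop :=
  ∀ (Y : Type u) [TopologicalSpace Y] (f : C(Y, X)) (S : E.Splitting f)
    (c : Fin E.rank → Cochain Y ℤ 2), (∀ j, (S.summand j).IsFirstChernCocycle (c j)) →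
      ∃ h : expSum c k ∈ cocycles Y ℚ (2 * k), pullback ℚ f (2 * k) γ = cls (expSum c k) h

open Classical in
/-- The integral Chern class `c_i(E) ∈ H^{2i}(X; ℤ)`. (By the splitting principle there is exactly
one class with the characterizing property; the alternative is never used.) -/
def chernClass (E : ComplexVectorBundle X) (i : ℕ) : H X ℤ (2 * i) :=
  if h : ∃! γ, E.IsChernClass i γ then h.choose else 0

open Classical in
/-- The Chern character `ch(E) = (ch_k(E))_k ∈ ∏_k H^{2k}(X; ℚ)`. (By the splitting principle there
is exactly one class with the characterizing property; the alternative is never used.) -/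
def chernCharacter (E : ComplexVectorBundle X) : ∀ k, H X ℚ (2 * k) :=
  fun k => if h : ∃! γ, E.IsChernCharacter k γ then h.choose else 0

end ComplexVectorBundle

/-! ## Symmetric powers, and bundle-valued holomorphic forms -/

section SymmetricPowers

variable (𝕜 : Type*) [RCLike 𝕜] (k : ℕ)

/-- The space of `k`-linear forms on the dual of `F`. -/
def DualForms (F : Type*) [NormedAddCommGroup F] [NormedSpace 𝕜 F] : Type _ :=
  ContinuousMultilinearMap 𝕜 (fun _ : Fin k => F →L[𝕜] 𝕜) 𝕜

set_option synthInstance.maxHeartbeats 200000 in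
instance (F : Type*) [NormedAddCommGroup F] [NormedSpace 𝕜 F] :
    NormedAddCommGroup (DualForms 𝕜 k F) :=
  ContinuousMultilinearMap.normedAddCommGroup (𝕜 := 𝕜) (E := fun _ : Fin k => F →L[𝕜] 𝕜) (G := 𝕜)

set_option synthInstance.maxHeartbeats 200000 in
instance (F : Type*) [NormedAddCommGroup F] [NormedSpace 𝕜 F] : NormedSpace 𝕜 (DualForms 𝕜 k F) :=
  ContinuousMultilinearMap.normedSpace (𝕜 := 𝕜) (E := fun _ : Fin k => F →L[𝕜] 𝕜) (G := 𝕜)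

instance (F : Type*) [NormedAddCommGroup F] [NormedSpace 𝕜 F] :
    FunLike (DualForms 𝕜 k F) (Fin k → F →L[𝕜] 𝕜) 𝕜 :=
  inferInstanceAs (FunLike (ContinuousMultilinearMap 𝕜 (fun _ : Fin k => F →L[𝕜] 𝕜) 𝕜) _ _)

instance (F : Type*) [NormedAddCommGroup F] [NormedSpace 𝕜 F]
    [FiniteDimensional 𝕜 F] : FiniteDimensional 𝕜 (DualForms 𝕜 k F) :=
  FiniteDimensional.of_injective
    ({ toFun := ContinuousMultilinearMap.toMultilinearMap
       map_add' := fun _ _ => rfl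
       map_smul' := fun _ _ => rfl } :
      DualForms 𝕜 k F →ₗ[𝕜] MultilinearMap 𝕜 (fun _ : Fin k => F →L[𝕜] 𝕜) 𝕜)
    ContinuousMultilinearMap.toMultilinearMap_injective

/-- The symmetric power `Sym^k(F)` of a finite-dimensional space `F`, realized as the space of
symmetric `k`-linear forms on the dual of `F`. -/
def SymPow (F : Type*) [NormedAddCommGroup F] [NormedSpace 𝕜 F] :
    Submodule 𝕜 (DualForms 𝕜 k F) where
  carrier := {m | ∀ (e : Equiv.Perm (Fin k)) (ξ : Fin k → F →L[𝕜] 𝕜), m (fun i => ξ (e i)) = m ξ}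
  add_mem' := fun ha hb e ξ => congrArg₂ (· + ·) (ha e ξ) (hb e ξ)
  zero_mem' := fun _ _ => rfl
  smul_mem' := fun c _ ha e ξ => congrArg (c • ·) (ha e ξ)

variable {F F' F'' : Type*} [NormedAddCommGroup F] [NormedSpace 𝕜 F]
  [NormedAddCommGroup F'] [NormedSpace 𝕜 F'] [NormedAddCommGroup F''] [NormedSpace 𝕜 F'']

set_option synthInstance.maxHeartbeats 200000 in
/-- Pull-back of `k`-linear forms on duals along the transpose of `A : F → F'`. -/
def dualFormsMap (A : F →L[𝕜] F') : DualForms 𝕜 k F →L[𝕜] DualForms 𝕜 k F' :=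
  ContinuousMultilinearMap.compContinuousLinearMapL
    (fun _ : Fin k => (ContinuousLinearMap.precomp 𝕜 A : (F' →L[𝕜] 𝕜) →L[𝕜] (F →L[𝕜] 𝕜)))

theorem dualFormsMap_apply (A : F →L[𝕜] F') (m : DualForms 𝕜 k F) (ξ : Fin k → F' →L[𝕜] 𝕜) :
    dualFormsMap 𝕜 k A m ξ = m (fun i => (ξ i).comp A) := rfl

set_option synthInstance.maxHeartbeats 200000 in
theorem continuous_dualFormsMap : Continuous (dualFormsMap 𝕜 k : (F →L[𝕜] F') → _) := by
  have h1 : Continuous (fun A : F →L[𝕜] F' => fun _ : Fin k =>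
      (ContinuousLinearMap.precomp 𝕜 A : (F' →L[𝕜] 𝕜) →L[𝕜] (F →L[𝕜] 𝕜))) :=
    continuous_pi fun _ => (ContinuousLinearMap.compL 𝕜 F F' 𝕜).flip.continuous
  exact (ContinuousMultilinearMap.compContinuousLinearMapContinuousMultilinear 𝕜
      (fun _ : Fin k => F' →L[𝕜] 𝕜) (fun _ : Fin k => F →L[𝕜] 𝕜) 𝕜).cont.comp h1

/-- The map `Sym^k(A) : Sym^k(F) → Sym^k(F')` induced by `A : F → F'`. -/
def symPowMap (A : F →L[𝕜] F') : SymPow 𝕜 k F →L[𝕜] SymPow 𝕜 k F' :=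
  ((dualFormsMap 𝕜 k A).comp (SymPow 𝕜 k F).subtypeL).codRestrict (SymPow 𝕜 k F')
    (fun m e ξ => m.2 e (fun i => (ξ i).comp A))

theorem symPowMap_id (m : SymPow 𝕜 k F) :
    symPowMap 𝕜 k (ContinuousLinearMap.id 𝕜 F) m = m := rfl

theorem symPowMap_comp (B : F' →L[𝕜] F'') (A : F →L[𝕜] F') (m : SymPow 𝕜 k F) :
    symPowMap 𝕜 k B (symPowMap 𝕜 k A m) = symPowMap 𝕜 k (B.comp A) m := rfl

theorem continuous_symPowMap [FiniteDimensional 𝕜 F] :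
    Continuous (symPowMap 𝕜 k : (F →L[𝕜] F') → _) := by
  rw [continuous_clm_apply]
  intro m
  exact Continuous.subtype_mk ((continuous_dualFormsMap 𝕜 k).clm_apply continuous_const) _

end SymmetricPowers

namespace ComplexVectorBundle

variable {X : Type u} [TopologicalSpace X]

/-- The cocycle of `Sym^k(E)`: the transition functions are the `Sym^k` of those of `E`. -/
def symPowCore (E : ComplexVectorBundle X) (k : ℕ) :
    VectorBundleCore ℂ X (SymPow ℂ k E.model) X where
  baseSet i := (trivializationAt E.model E.fiber i).baseSet
  isOpen_baseSet i := (trivializationAt E.model E.fiber i).open_baseSet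
  indexAt x := x
  mem_baseSet_at x := mem_baseSet_trivializationAt E.model E.fiber x
  coordChange i j x := symPowMap ℂ k
    ((trivializationAt E.model E.fiber i).coordChangeL ℂ (trivializationAt E.model E.fiber j) x :
      E.model →L[ℂ] E.model)
  coordChange_self i x hx m := by
    convert symPowMap_id ℂ k m using 2
    congr 1
    ext v
    simp [Trivialization.coordChangeL_apply, hx]
  continuousOn_coordChange i j :=
    (continuous_symPowMap ℂ k).comp_continuousOn
      (continuousOn_coordChange ℂ (trivializationAt E.model E.fiber i)
        (trivializationAt E.model E.fiber j))
  coordChange_comp i j l x hx m := by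
    rw [symPowMap_comp]
    congr 2
    ext v
    obtain ⟨⟨hi, hj⟩, hl⟩ := hx
    simp [Trivialization.coordChangeL_apply, hi, hj, hl]

/-- The symmetric power `Sym^k(E)` of a complex vector bundle. -/
def symPow (E : ComplexVectorBundle X) (k : ℕ) : ComplexVectorBundle X where
  model := SymPow ℂ k E.model
  fiber := (E.symPowCore k).Fiber

instance (E : ComplexVectorBundle X) (x : X) : IsTopologicalAddGroup (E.fiber x) :=
  let L := (trivializationAt E.model E.fiber x).continuousLinearEquivAt ℂ x
    (mem_baseSet_trivializationAt _ _ _)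
  L.toHomeomorph.isInducing.topologicalAddGroup (L : E.fiber x →ₗ[ℂ] E.model)

instance (E : ComplexVectorBundle X) (x : X) : ContinuousSMul ℂ (E.fiber x) :=
  let L := (trivializationAt E.model E.fiber x).continuousLinearEquivAt ℂ x
    (mem_baseSet_trivializationAt _ _ _)
  L.toHomeomorph.isInducing.continuousSMul continuous_id (fun {c v} => L.map_smul c v)

/-- The bundle `Ω^k_M ⊗ E` on a complex manifold `M`, where `Ω^k_M` is the `k`-th exterior power of
the holomorphic cotangent bundle: the fibre at `x` is the space of `E_x`-valued `ℂ`-multilinear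
alternating `k`-forms on `T_x M`. -/
def formsTensor {V : Type u} [NormedAddCommGroup V] [NormedSpace ℂ V] [FiniteDimensional ℂ V]
    {M : Type u} [TopologicalSpace M] [ChartedSpace V M] [IsManifold 𝓘(ℂ, V) ω M]
    (k : ℕ) (E : ComplexVectorBundle M) : ComplexVectorBundle M where
  model := V [⋀^Fin k]→L[ℂ] E.model
  finiteModel := FiniteDimensional.of_injective
    ({ toFun := fun m => m.toContinuousMultilinearMap.toMultilinearMap
       map_add' := fun _ _ => rfl
       map_smul' := fun _ _ => rfl } :
      (V [⋀^Fin k]→L[ℂ] E.model) →ₗ[ℂ] MultilinearMap ℂ (fun _ : Fin k => V) E.model)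
    (ContinuousMultilinearMap.toMultilinearMap_injective.comp
      ContinuousAlternatingMap.toContinuousMultilinearMap_injective)
  fiber x := TangentSpace 𝓘(ℂ, V) x [⋀^Fin k]→L[ℂ] E.fiber x

end ComplexVectorBundle

/-! ## Principal bundles, connections, compatible pairs -/

section Principal

/-- A Lie group is sufficiently smooth for its Lie algebra to be defined. -/
instance lieGroup_minSmoothness {EG G : Type*} [NormedAddCommGroup EG] [NormedSpace ℝ EG]
    [TopologicalSpace G] [ChartedSpace EG G] [Group G] [LieGroup 𝓘(ℝ, EG) ∞ G] :
    LieGroup 𝓘(ℝ, EG) (minSmoothness ℝ 3) G := by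
  rw [minSmoothness_of_isRCLikeNormedField]
  infer_instance

/-- The adjoint representation: `Ad g` is the derivative at `1` of `x ↦ g x g⁻¹`. -/
def Ad {EG G : Type*} [NormedAddCommGroup EG] [NormedSpace ℝ EG]
    [TopologicalSpace G] [ChartedSpace EG G] [Group G] (g : G) (X : GroupLieAlgebra 𝓘(ℝ, EG) G) :
    GroupLieAlgebra 𝓘(ℝ, EG) G :=
  (mfderiv 𝓘(ℝ, EG) 𝓘(ℝ, EG) (fun x : G => g * x * g⁻¹) 1 : EG →L[ℝ] EG) X

/-- The Lie bracket of `𝔤`. -/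
def lieBr {EG : Type*} (G : Type*) [NormedAddCommGroup EG] [NormedSpace ℝ EG]
    [TopologicalSpace G] [ChartedSpace EG G] [Group G]
    (X Y : GroupLieAlgebra 𝓘(ℝ, EG) G) : GroupLieAlgebra 𝓘(ℝ, EG) G :=
  ⁅X, Y⁆

/-- The exterior derivative `dα(u, v) = D_u α(v) - D_v α(u)` at `p` of a 1-form `α` on a manifold
`P` with values in a normed space, computed in the preferred chart at `p`. -/
def extDerivOneForm {EP P W : Type*} [NormedAddCommGroup EP] [NormedSpace ℝ EP]
    [TopologicalSpace P] [ChartedSpace EP P] [NormedAddCommGroup W] [NormedSpace ℝ W]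
    (α : ∀ p : P, TangentSpace 𝓘(ℝ, EP) p →L[ℝ] W) (p : P) :
    TangentSpace 𝓘(ℝ, EP) p →L[ℝ] TangentSpace 𝓘(ℝ, EP) p →L[ℝ] W :=
  let χ := extChartAt 𝓘(ℝ, EP) p
  let β : EP → EP →L[ℝ] W := fun y =>
    (α (χ.symm y)).comp (mfderiv 𝓘(ℝ, EP) 𝓘(ℝ, EP) χ.symm y)
  let dβ : EP →L[ℝ] EP →L[ℝ] W := fderiv ℝ β (χ p)
  dβ - dβ.flip

/-- A 1-form with values in a normed space is of class `C^n`. -/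
def OneFormContMDiff {EP P W : Type*} [NormedAddCommGroup EP] [NormedSpace ℝ EP]
    [TopologicalSpace P] [ChartedSpace EP P] [NormedAddCommGroup W] [NormedSpace ℝ W]
    [IsManifold 𝓘(ℝ, EP) ∞ P] (n : ℕ∞ω)
    (α : ∀ p : P, TangentSpace 𝓘(ℝ, EP) p →L[ℝ] W) : Prop :=
  ContMDiff 𝓘(ℝ, EP).tangent 𝓘(ℝ, W) n (fun v : TangentBundle 𝓘(ℝ, EP) P => α v.proj v.2)

/-- A smooth principal `G`-bundle `P → M` (with right action `act`). -/
structure PrincipalBundle (EM M EG G EP P : Type*)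
    [NormedAddCommGroup EM] [NormedSpace ℝ EM] [TopologicalSpace M] [ChartedSpace EM M]
    [NormedAddCommGroup EG] [NormedSpace ℝ EG] [TopologicalSpace G] [ChartedSpace EG G] [Group G]
    [NormedAddCommGroup EP] [NormedSpace ℝ EP] [TopologicalSpace P] [ChartedSpace EP P] where
  /-- the projection -/
  proj : P → M
  /-- the right action -/
  act : P → G → P
  contMDiff_proj : ContMDiff 𝓘(ℝ, EP) 𝓘(ℝ, EM) ∞ proj
  contMDiff_act : ContMDiff (𝓘(ℝ, EP).prod 𝓘(ℝ, EG)) 𝓘(ℝ, EP) ∞ (fun q : P × G => act q.1 q.2)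
  act_one : ∀ p, act p 1 = p
  act_mul : ∀ p g h, act p (g * h) = act (act p g) h
  proj_act : ∀ p g, proj (act p g) = proj p
  act_free : ∀ p g, act p g = p → g = 1
  /-- local triviality: near each point there are a smooth section `s` and a smooth `G`-valued
  coordinate `γ` with `p = s(π(p)) · γ(p)` -/
  locally_trivial : ∀ x₀ : M, ∃ U : Set M, IsOpen U ∧ x₀ ∈ U ∧ ∃ (s : M → P) (γ : P → G),
    ContMDiffOn 𝓘(ℝ, EM) 𝓘(ℝ, EP) ∞ s U ∧ ContMDiffOn 𝓘(ℝ, EP) 𝓘(ℝ, EG) ∞ γ (proj ⁻¹' U) ∧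
    (∀ x ∈ U, proj (s x) = x) ∧ ∀ p, proj p ∈ U → act (s (proj p)) (γ p) = p

namespace PrincipalBundle

variable {EM M EG G EP P : Type*}
    [NormedAddCommGroup EM] [NormedSpace ℝ EM] [TopologicalSpace M] [ChartedSpace EM M]
    [NormedAddCommGroup EG] [NormedSpace ℝ EG] [TopologicalSpace G] [ChartedSpace EG G] [Group G]
    [NormedAddCommGroup EP] [NormedSpace ℝ EP] [TopologicalSpace P] [ChartedSpace EP P]

theorem proj_surjective (B : PrincipalBundle EM M EG G EP P) : Function.Surjective B.proj := by
  intro x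
  obtain ⟨U, -, hx, s, -, -, -, hs, -⟩ := B.locally_trivial x
  exact ⟨s x, hs x hx⟩

variable [CompleteSpace EG] [LieGroup 𝓘(ℝ, EG) ∞ G] [IsManifold 𝓘(ℝ, EP) ∞ P]

/-- The differential of the right translation `R_g : P → P` at `p`. -/
def dR (B : PrincipalBundle EM M EG G EP P) (g : G) (p : P) :
    TangentSpace 𝓘(ℝ, EP) p →L[ℝ] TangentSpace 𝓘(ℝ, EP) (B.act p g) :=
  mfderiv 𝓘(ℝ, EP) 𝓘(ℝ, EP) (fun q => B.act q g) p

/-- The fundamental vector field of `X ∈ 𝔤` at `p`: the derivative at `1` of `g ↦ p · g`, applied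
to `X`. -/
def fundamental (B : PrincipalBundle EM M EG G EP P) (p : P) (X : GroupLieAlgebra 𝓘(ℝ, EG) G) :
    TangentSpace 𝓘(ℝ, EP) p :=
  (mfderiv 𝓘(ℝ, EG) 𝓘(ℝ, EP) (fun g : G => B.act p g) 1 : EG →L[ℝ] EP) X

/-- The vertical subspace `V_p = ker dπ_p`. -/
def vertical (B : PrincipalBundle EM M EG G EP P) (p : P) :
    Submodule ℝ (TangentSpace 𝓘(ℝ, EP) p) :=
  LinearMap.ker (mfderiv 𝓘(ℝ, EP) 𝓘(ℝ, EM) B.proj p : EP →L[ℝ] EM).toLinearMap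

/-- `w` is a principal connection form of class `C^3`. -/
structure IsConnection (B : PrincipalBundle EM M EG G EP P)
    (w : ∀ p : P, TangentSpace 𝓘(ℝ, EP) p →L[ℝ] EG) : Prop where
  contMDiff : OneFormContMDiff 3 w
  fundamental : ∀ p (X : GroupLieAlgebra 𝓘(ℝ, EG) G), w p (B.fundamental p X) = X
  equivariant : ∀ p g u, w (B.act p g) (B.dR g p u) = Ad g⁻¹ (w p u)

/-- `(D, lam)` is a compatible pair on `P` with connection form `w`: `D` is a distribution on `P`
and `lam` is a `𝔤*`-valued 1-form on `P`. -/
structure IsCompatiblePair (B : PrincipalBundle EM M EG G EP P)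
    (w : ∀ p : P, TangentSpace 𝓘(ℝ, EP) p →L[ℝ] EG)
    (D : ∀ p : P, Submodule ℝ (TangentSpace 𝓘(ℝ, EP) p))
    (lam : ∀ p : P, TangentSpace 𝓘(ℝ, EP) p →L[ℝ] (EG →L[ℝ] ℝ)) : Prop where
  contMDiff : OneFormContMDiff 1 lam
  /-- strong transversality -/
  sup_vertical : ∀ p, D p ⊔ B.vertical p = ⊤
  inf_vertical : ∀ p, D p ⊓ B.vertical p = ⊥
  /-- the modified Cartan equation `d lam + ad*_w ∧ lam = 0`, with `(ad*_X ξ)(Z) = -ξ([X, Z])` -/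
  cartan : ∀ p (u v : TangentSpace 𝓘(ℝ, EP) p) (Z : GroupLieAlgebra 𝓘(ℝ, EG) G),
    extDerivOneForm lam p u v Z
      - lam p v (lieBr G (w p u) Z)
      + lam p u (lieBr G (w p v) Z) = 0
  /-- `D_p = {v : ⟨lam(p), w(v)⟩ = 0}`, an identity of covectors on `T_p P` -/
  compatible : ∀ p v, v ∈ D p ↔ ∀ u, lam p u (w p v) = 0
  /-- `R_g^* D = D` -/
  equivariant_D : ∀ p g, (D p).map (B.dR g p).toLinearMap = D (B.act p g)
  /-- `R_g^* lam = Ad*_{g⁻¹} lam`, with `(Ad*_{g⁻¹} ξ)(Z) = ξ(Ad_g Z)` -/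
  equivariant_lam : ∀ p g u (Z : GroupLieAlgebra 𝓘(ℝ, EG) G),
    lam (B.act p g) (B.dR g p u) Z = lam p u (Ad g Z)

/-- The curvature `Ω = dw + ½[w ∧ w]` at `p`, as a bilinear map:
`Ω(u, v) = dw(u, v) + [w(u), w(v)]`. -/
def curvature (_B : PrincipalBundle EM M EG G EP P)
    (w : ∀ p : P, TangentSpace 𝓘(ℝ, EP) p →L[ℝ] EG) (p : P) :
    TangentSpace 𝓘(ℝ, EP) p →ₗ[ℝ] TangentSpace 𝓘(ℝ, EP) p →ₗ[ℝ] EG :=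
  LinearMap.mk₂ ℝ (fun u v => extDerivOneForm w p u v + (show EG from lieBr G (w p u) (w p v)))
    (fun u u' v => by
      have h : lieBr G (w p (u + u')) (w p v) = lieBr G (w p u) (w p v) + lieBr G (w p u') (w p v) := by
        rw [map_add]; exact add_lie (L := GroupLieAlgebra 𝓘(ℝ, EG) G) _ _ _
      rw [map_add, add_apply, h]
      exact add_add_add_comm (G := EG) _ _ _ _)
    (fun c u v => by
      have h : lieBr G (w p (c • u)) (w p v) = c • lieBr G (w p u) (w p v) := by
        rw [map_smul]; exact smul_lie (L := GroupLieAlgebra 𝓘(ℝ, EG) G) _ _ _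
      rw [map_smul, smul_apply, h]
      exact (smul_add (A := EG) _ _ _).symm)
    (fun u v v' => by
      have h : lieBr G (w p u) (w p (v + v')) = lieBr G (w p u) (w p v) + lieBr G (w p u) (w p v') := by
        rw [map_add]; exact lie_add (L := GroupLieAlgebra 𝓘(ℝ, EG) G) _ _ _
      rw [map_add, h]
      exact add_add_add_comm (G := EG) _ _ _ _)
    (fun c u v => by
      have h : lieBr G (w p u) (w p (c • v)) = c • lieBr G (w p u) (w p v) := by
        rw [map_smul]; exact lie_smul (L := GroupLieAlgebra 𝓘(ℝ, EG) G) _ _ _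
      rw [map_smul, h]
      exact (smul_add (A := EG) _ _ _).symm)

/-- The auxiliary choices in the two Spencer metrics, e.g. those induced by a `G`-invariant
Riemannian metric on `P`, an `Ad`-invariant inner product on `𝔤` and a Riemannian metric on `M`. -/
structure SpencerMetricData (B : PrincipalBundle EM M EG G EP P) [MeasurableSpace M] where
  /-- a norm on `𝔤*`-valued covectors at `p` -/
  normForm : ∀ p : P, Seminorm ℝ (TangentSpace 𝓘(ℝ, EP) p →L[ℝ] (EG →L[ℝ] ℝ))
  normForm_definite : ∀ p α, normForm p α = 0 → α = 0
  normForm_invariant : ∀ p g (α : TangentSpace 𝓘(ℝ, EP) p →L[ℝ] (EG →L[ℝ] ℝ))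
    (α' : TangentSpace 𝓘(ℝ, EP) (B.act p g) →L[ℝ] (EG →L[ℝ] ℝ)),
    (∀ u (Z : GroupLieAlgebra 𝓘(ℝ, EG) G), α' (B.dR g p u) Z = α u (Ad g Z)) →
      normForm (B.act p g) α' = normForm p α
  /-- a norm on `𝔤`-valued bilinear forms at `p` -/
  normCurv : ∀ p : P, Seminorm ℝ (TangentSpace 𝓘(ℝ, EP) p →ₗ[ℝ]
    TangentSpace 𝓘(ℝ, EP) p →ₗ[ℝ] EG)
  normCurv_definite : ∀ p α, normCurv p α = 0 → α = 0
  normCurv_invariant : ∀ p g α α', (∀ u v, α' (B.dR g p u) (B.dR g p v) = Ad g⁻¹ (α u v)) →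
    normCurv (B.act p g) α' = normCurv p α
  /-- the standard inner product on the fibre of `Λ^k T^*M ⊗ Sym^k(𝔤)` at `x` -/
  std : ∀ (k : ℕ) (x : M),
    LinearMap.BilinForm ℝ (TangentSpace 𝓘(ℝ, EM) x [⋀^Fin k]→L[ℝ] SymPow ℝ k EG)
  std_symm : ∀ k x u v, std k x u v = std k x v u
  std_pos : ∀ k x u, u ≠ 0 → 0 < std k x u u
  /-- the Riemannian volume measure of `M` -/
  vol : MeasureTheory.Measure M
  vol_finite : MeasureTheory.IsFiniteMeasure vol
  vol_pos : vol.IsOpenPosMeasure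

/-- Spencer cochains: fields of `Sym^k(𝔤)`-valued `k`-forms on `M`. -/
abbrev SpencerField (_B : PrincipalBundle EM M EG G EP P) (k : ℕ) : Type _ :=
  ∀ x : M, TangentSpace 𝓘(ℝ, EM) x [⋀^Fin k]→L[ℝ] SymPow ℝ k EG

/-- A point of the fibre over `x`. -/
def pointOver (B : PrincipalBundle EM M EG G EP P) (x : M) : P :=
  Function.surjInv B.proj_surjective x

/-- The constraint strength metric `⟨u₁, u₂⟩_A = ∫_M (1 + ‖lam(p)‖²) ⟨u₁, u₂⟩_std dV`, where
`p ∈ π⁻¹(x)`. -/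
def spencerMetricA {B : PrincipalBundle EM M EG G EP P} [MeasurableSpace M]
    (S : B.SpencerMetricData)
    (lam : ∀ p : P, TangentSpace 𝓘(ℝ, EP) p →L[ℝ] (EG →L[ℝ] ℝ)) (k : ℕ)
    (u₁ u₂ : B.SpencerField k) : ℝ :=
  ∫ x, (1 + S.normForm (B.pointOver x) (lam (B.pointOver x)) ^ 2) * S.std k x (u₁ x) (u₂ x) ∂S.vol

/-- The curvature geometric metric `⟨u₁, u₂⟩_B = ∫_M (1 + ‖Ω_p‖²) ⟨u₁, u₂⟩_std dV`, where
`p ∈ π⁻¹(x)`; it is attached to `lam` but does not involve it. -/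
def spencerMetricB {B : PrincipalBundle EM M EG G EP P} [MeasurableSpace M]
    (S : B.SpencerMetricData) (w : ∀ p : P, TangentSpace 𝓘(ℝ, EP) p →L[ℝ] EG)
    (_lam : ∀ p : P, TangentSpace 𝓘(ℝ, EP) p →L[ℝ] (EG →L[ℝ] ℝ)) (k : ℕ)
    (u₁ u₂ : B.SpencerField k) : ℝ :=
  ∫ x, (1 + S.normCurv (B.pointOver x) (B.curvature w (B.pointOver x)) ^ 2) *
    S.std k x (u₁ x) (u₂ x) ∂S.vol

/-- `E` is (a model of) the complexified adjoint bundle `𝒢 = P ×_G (𝔤 ⊗ ℂ)`: there are linear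
isomorphisms `X ↦ [p, X]` from `𝔤 ⊗ ℂ` to the fibre of `E` over `π(p)`, jointly continuous in `p`
and `X`, with `[p · g, X] = [p, Ad_g X]`. -/
def IsAdjointBundle {EM EG G EP P : Type*} {M : Type u}
    [NormedAddCommGroup EM] [NormedSpace ℝ EM] [TopologicalSpace M] [ChartedSpace EM M]
    [NormedAddCommGroup EG] [NormedSpace ℝ EG] [TopologicalSpace G] [ChartedSpace EG G] [Group G]
    [NormedAddCommGroup EP] [NormedSpace ℝ EP] [TopologicalSpace P] [ChartedSpace EP P]
    (B : PrincipalBundle EM M EG G EP P) (E : ComplexVectorBundle M) : Prop :=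
  ∃ q : ∀ p : P, (ℂ ⊗[ℝ] GroupLieAlgebra 𝓘(ℝ, EG) G) ≃ₗ[ℂ] E.fiber (B.proj p),
    Continuous (fun a : P × GroupLieAlgebra 𝓘(ℝ, EG) G =>
      (⟨B.proj a.1, q a.1 (1 ⊗ₜ a.2)⟩ : E.Total)) ∧
    ∀ (p : P) (g : G) (X : GroupLieAlgebra 𝓘(ℝ, EG) G),
      (⟨B.proj (B.act p g), q (B.act p g) (1 ⊗ₜ X)⟩ : E.Total) =
        ⟨B.proj p, q p (1 ⊗ₜ Ad g X)⟩

end PrincipalBundle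

end Principal

end

noncomputable section

/-! ## Isomorphisms of complex vector bundles -/

namespace ComplexVectorBundle

variable {X : Type u} [TopologicalSpace X]

/-! The sign of `lam` enters in three places, and in each it disappears. The conditions defining a
compatible pair are homogeneous in `lam`, so they survive negation. The first Spencer metric sees
`lam` only through a seminorm, and the curvature metric does not see it at all. The adjoint bundle
depends on `P` and `Ad` alone, so `E` and `E'` are two models of one bundle.

The work is to turn this last remark into equality of classes. If `q p` and `q' p` are the maps `X ↦
[p, X]` of two models, then `q' p ∘ (q p)⁻¹` is an isomorphism between the fibres over `π(p)`.
Moving `p` along its fibre precomposes both maps with the same `Ad g`, so the composite depends only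
on `π(p)` (`transfer_unique`). Evaluated along a local section of `P` it is a product of an
invertible frame and the inverse of another, hence continuous (`continuous_fiberEquiv`).

An isomorphism `E ≅ E'` induces isomorphisms of symmetric powers and of bundles of forms. It also
carries splittings of `f^*E` to splittings of `f^*E'` with the same first Chern cocycles
(`isFirstChernCocycle_mapLine`). The properties characterizing Chern classes and the Chern character
are therefore the same for both bundles. Since each class is defined as the unique one with its
property, the classes coincide; the splitting principle itself is not needed. -/

/-- A topological isomorphism of complex vector bundles over `X`. -/
structure Iso (E E' : ComplexVectorBundle X) where
  /-- the isomorphism of the fibres at a point -/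
  fiberEquiv : ∀ x, E.fiber x ≃ₗ[ℂ] E'.fiber x
  continuous_total : Continuous (fun v : E.Total => (⟨v.1, fiberEquiv v.1 v.2⟩ : E'.Total))
  continuous_total_symm :
    Continuous (fun v : E'.Total => (⟨v.1, (fiberEquiv v.1).symm v.2⟩ : E.Total))

/-- A fibrewise linear map is continuous on total spaces if it has continuous local
representations. -/
theorem continuous_total_of_local {E E' : ComplexVectorBundle X}
    (φ : ∀ x, E.fiber x →ₗ[ℂ] E'.fiber x)
    (h : ∀ x₀, ∃ A : X → E.model →L[ℂ] E'.model, ContinuousAt A x₀ ∧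
      ∀ᶠ x in 𝓝 x₀, ∀ v : E.fiber x,
        (trivializationAt E'.model E'.fiber x₀ ⟨x, φ x v⟩).2 =
          A x (trivializationAt E.model E.fiber x₀ ⟨x, v⟩).2) :
    Continuous (fun v : E.Total => (⟨v.1, φ v.1 v.2⟩ : E'.Total)) := by
  rw [continuous_iff_continuousAt]
  intro v₀
  have hp : ContinuousAt (fun v : E.Total => v.1) v₀ :=
    (FiberBundle.continuous_proj E.model E.fiber).continuousAt
  obtain ⟨A, hA, hev⟩ := h v₀.1
  rw [FiberBundle.continuousAt_totalSpace]
  refine ⟨hp, ?_⟩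
  -- Continuity of the identity of the total space, read in the trivialization at `v₀.1`, says that
  -- the fibre coordinate is continuous at `v₀`.
  have h2 := ((FiberBundle.continuousAt_totalSpace (F := E.model) (E := E.fiber) id).1
    (continuousAt_id (x := v₀))).2
  have h3 : ContinuousAt
      (fun v : E.Total => A v.1 (trivializationAt E.model E.fiber v₀.1 v).2) v₀ :=
    (ContinuousAt.comp (f := fun v : E.Total => v.1) hA hp).clm_apply h2
  exact h3.congr ((hp.eventually hev).mono fun v hv => (hv v.2).symm)

namespace Iso

variable {E E' : ComplexVectorBundle X}

/-- The inverse isomorphism. -/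
def symm (e : Iso E E') : Iso E' E where
  fiberEquiv x := (e.fiberEquiv x).symm
  continuous_total := e.continuous_total_symm
  continuous_total_symm := e.continuous_total

/-- The local representation at `x` of an isomorphism in the preferred trivializations at `x₀`. -/
def rep (e : Iso E E') (x₀ x : X) : E.model →L[ℂ] E'.model :=
  LinearMap.toContinuousLinearMap
    (((trivializationAt E'.model E'.fiber x₀).linearMapAt ℂ x) ∘ₗ (e.fiberEquiv x).toLinearMap ∘ₗ
      ((trivializationAt E.model E.fiber x₀).symmₗ ℂ x))

/-- The domain of the preferred trivialization at `x₀`. -/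
abbrev base (E : ComplexVectorBundle X) (x₀ : X) : Set X :=
  (trivializationAt E.model E.fiber x₀).baseSet

theorem base_mem_nhds (E : ComplexVectorBundle X) (x₀ : X) : base E x₀ ∈ 𝓝 x₀ :=
  (trivializationAt E.model E.fiber x₀).open_baseSet.mem_nhds
    (mem_baseSet_trivializationAt _ _ _)

/-- `rep` is defined at every `x` because `linearMapAt` and `symmₗ` vanish off the base sets; on
them it is the honest coordinate expression of `e`. -/
theorem rep_apply (e : Iso E E') {x₀ x : X} (hx : x ∈ base E x₀) (hx' : x ∈ base E' x₀)
    (m : E.model) :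
    e.rep x₀ x m = (trivializationAt E'.model E'.fiber x₀
      ⟨x, e.fiberEquiv x ((trivializationAt E.model E.fiber x₀).symm x m)⟩).2 := by
  change (trivializationAt E'.model E'.fiber x₀).linearMapAt ℂ x (e.fiberEquiv x
    ((trivializationAt E.model E.fiber x₀).symmₗ ℂ x m)) = _
  rw [Trivialization.coe_linearMapAt_of_mem _ hx', Trivialization.symmₗ_apply _ hx]

theorem rep_trivialization (e : Iso E E') {x₀ x : X} (hx : x ∈ base E x₀) (hx' : x ∈ base E' x₀)
    (v : E.fiber x) :
    e.rep x₀ x (trivializationAt E.model E.fiber x₀ ⟨x, v⟩).2 =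
      (trivializationAt E'.model E'.fiber x₀ ⟨x, e.fiberEquiv x v⟩).2 := by
  rw [rep_apply e hx hx', Trivialization.symm_apply_apply_mk _ hx]

theorem rep_symm_comp_rep (e : Iso E E') {x₀ x : X} (hx : x ∈ base E x₀) (hx' : x ∈ base E' x₀) :
    (e.symm.rep x₀ x).comp (e.rep x₀ x) = ContinuousLinearMap.id ℂ E.model := by
  ext m
  change e.symm.rep x₀ x (e.rep x₀ x m) = m
  rw [rep_apply e hx hx', rep_trivialization e.symm hx' hx]
  change (trivializationAt E.model E.fiber x₀ ⟨x, (e.fiberEquiv x).symm (e.fiberEquiv x _)⟩).2 = m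
  rw [LinearEquiv.symm_apply_apply, Trivialization.apply_mk_symm _ hx]

/-- The model fibre is finite-dimensional, so operator-norm continuity can be tested on each vector
`m`. There it is continuity of the image under `e` of the local section with constant coordinate
`m`. -/
theorem continuousAt_rep (e : Iso E E') (x₀ : X) : ContinuousAt (e.rep x₀) x₀ := by
  rw [continuousAt_clm_apply]
  intro m
  have hmem := mem_baseSet_trivializationAt E.model E.fiber x₀
  have h1 : ContinuousAt (fun x => (⟨x, (trivializationAt E.model E.fiber x₀).symm x m⟩ : E.Total))
      x₀ := by
    have h := ((trivializationAt E.model E.fiber x₀).continuousOn_symm (x₀, m) ⟨hmem, trivial⟩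
      |>.continuousAt (((trivializationAt E.model E.fiber x₀).open_baseSet.prod
        isOpen_univ).mem_nhds ⟨hmem, trivial⟩))
    exact ContinuousAt.comp (f := fun x : X => (x, m)) h (by fun_prop)
  have h2 := ((FiberBundle.continuousAt_totalSpace (F := E'.model) (E := E'.fiber) _).1
    (e.continuous_total.continuousAt.comp h1)).2
  refine h2.congr ?_
  filter_upwards [base_mem_nhds E x₀, base_mem_nhds E' x₀] with x hx hx'
  exact (rep_apply e hx hx' m).symm

/-- The rank is read off the model fibre, which is tied to the actual fibres only over a point;
hence the nonempty base. -/
theorem rank_eq [Nonempty X] (e : Iso E E') : E.rank = E'.rank := by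
  obtain ⟨x⟩ := ‹Nonempty X›
  have l (E : ComplexVectorBundle X) : E.fiber x ≃ₗ[ℂ] E.model :=
    ((trivializationAt E.model E.fiber x).continuousLinearEquivAt ℂ x
      (mem_baseSet_trivializationAt _ _ _)).toLinearEquiv
  exact ((l E).symm.trans ((e.fiberEquiv x).trans (l E'))).finrank_eq

end Iso

end ComplexVectorBundle

/-! ## Functoriality of symmetric powers and of bundle-valued forms -/

namespace ComplexVectorBundle

variable {X : Type u} [TopologicalSpace X] {E E' : ComplexVectorBundle X}

namespace Iso

/-- The map induced by an isomorphism on the fibres of the symmetric powers. -/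
def symPowFiber (e : Iso E E') (k : ℕ) (x : X) : (E.symPow k).fiber x →ₗ[ℂ] (E'.symPow k).fiber x :=
  (symPowMap ℂ k (e.rep x x)).toLinearMap

theorem symPowFiber_symm (e : Iso E E') (k : ℕ) (x : X) (m : (E.symPow k).fiber x) :
    e.symm.symPowFiber k x (e.symPowFiber k x m) = m := by
  have h := rep_symm_comp_rep e (x₀ := x) (mem_baseSet_trivializationAt _ _ _)
    (mem_baseSet_trivializationAt _ _ _)
  have key : ∀ m : SymPow ℂ k E.model,
      symPowMap ℂ k (e.symm.rep x x) (symPowMap ℂ k (e.rep x x) m) = m := fun m => by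
    rw [symPowMap_comp, h, symPowMap_id]
  exact key m

/-- Both sides are `e` at `x`, read in the trivialization at `x` on the source and at `x₀` on the
target. `symPowFiber` uses a frame that moves with `x`; this identity replaces it by the fixed frame
at `x₀`, in which continuity makes sense. -/
theorem coordChange_comp_rep (e : Iso E E') {x₀ x : X} (hx : x ∈ base E x₀)
    (hx' : x ∈ base E' x₀) :
    ((trivializationAt E'.model E'.fiber x).coordChangeL ℂ
        (trivializationAt E'.model E'.fiber x₀) x : E'.model →L[ℂ] E'.model).comp (e.rep x x) =
      (e.rep x₀ x).comp ((trivializationAt E.model E.fiber x).coordChangeL ℂ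
        (trivializationAt E.model E.fiber x₀) x : E.model →L[ℂ] E.model) := by
  have hs : x ∈ base E x := mem_baseSet_trivializationAt _ _ _
  have hs' : x ∈ base E' x := mem_baseSet_trivializationAt _ _ _
  ext m
  simp only [ContinuousLinearMap.comp_apply, ContinuousLinearEquiv.coe_coe]
  rw [Trivialization.coordChangeL_apply _ _ ⟨hs', hx'⟩, Trivialization.coordChangeL_apply _ _
    ⟨hs, hx⟩, rep_trivialization e hx hx', rep_apply e hs hs',
    Trivialization.symm_apply_apply_mk _ hs']

theorem continuous_symPowFiber (e : Iso E E') (k : ℕ) :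
    Continuous (fun v : (E.symPow k).Total =>
      (⟨v.1, e.symPowFiber k v.1 v.2⟩ : (E'.symPow k).Total)) := by
  apply continuous_total_of_local
  intro x₀
  refine ⟨fun x => symPowMap ℂ k (e.rep x₀ x), (continuous_symPowMap ℂ k).continuousAt.comp
    (e.continuousAt_rep x₀), ?_⟩
  filter_upwards [base_mem_nhds E x₀, base_mem_nhds E' x₀] with x hx hx' v
  -- The fibre of `symPow` at `x` is by definition `SymPow` of the model, seen in the trivialization
  -- indexed by `x`; its coordinate at `x₀` is `Sym^k` of the transition map.
  have key : ∀ m : SymPow ℂ k E.model, symPowMap ℂ k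
      ((trivializationAt E'.model E'.fiber x).coordChangeL ℂ
        (trivializationAt E'.model E'.fiber x₀) x : E'.model →L[ℂ] E'.model)
      (symPowMap ℂ k (e.rep x x) m) =
    symPowMap ℂ k (e.rep x₀ x) (symPowMap ℂ k
      ((trivializationAt E.model E.fiber x).coordChangeL ℂ
        (trivializationAt E.model E.fiber x₀) x : E.model →L[ℂ] E.model) m) := fun m => by
    rw [symPowMap_comp, symPowMap_comp, coordChange_comp_rep e hx hx']
  exact key v

/-- Isomorphic bundles have isomorphic symmetric powers. -/
def symPow (e : Iso E E') (k : ℕ) : Iso (E.symPow k) (E'.symPow k) where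
  fiberEquiv x := LinearEquiv.ofLinearMap (e.symPowFiber k x) (e.symm.symPowFiber k x)
    (LinearMap.ext (e.symm.symPowFiber_symm k x)) (LinearMap.ext (e.symPowFiber_symm k x))
  continuous_total := e.continuous_symPowFiber k
  continuous_total_symm := e.symm.continuous_symPowFiber k

/-- The isomorphism of the fibres at a point, as a continuous linear map. -/
def fiberMap (e : Iso E E') (x : X) : E.fiber x →L[ℂ] E'.fiber x where
  toLinearMap := (e.fiberEquiv x).toLinearMap
  cont := by
    have h : Continuous (fun v : E.fiber x => (⟨x, e.fiberEquiv x v⟩ : E'.Total)) :=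
      e.continuous_total.comp (FiberBundle.continuous_totalSpaceMk E.model E.fiber x)
    exact (FiberBundle.totalSpaceMk_isInducing E'.model E'.fiber x).continuous_iff.2 h

end Iso

/-! ### Functoriality of bundle-valued holomorphic forms. -/

section Forms

variable {V : Type u} [NormedAddCommGroup V] [NormedSpace ℂ V] [FiniteDimensional ℂ V]
  {M : Type u} [TopologicalSpace M] [ChartedSpace V M] [IsManifold 𝓘(ℂ, V) ω M]
  {E E' : ComplexVectorBundle M}

namespace Iso

variable (V) in
/-- The map induced by an isomorphism on the fibres of the bundles of `k`-forms. -/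
def formsFiber (e : Iso E E') (k : ℕ) (x : M) :
    (E.formsTensor (V := V) k).fiber x →ₗ[ℂ] (E'.formsTensor (V := V) k).fiber x :=
  (ContinuousLinearMap.compContinuousAlternatingMapCLM (ι := Fin k) ℂ (TangentSpace 𝓘(ℂ, V) x)
    (E.fiber x) (E'.fiber x) (e.fiberMap x)).toLinearMap

/-- The tangent arguments are trivialized alike on both sides, so the local representation is
postcomposition with that of `e`, which depends continuously on the operator. -/
theorem continuous_formsFiber (e : Iso E E') (k : ℕ) :
    Continuous (fun v : (E.formsTensor (V := V) k).Total =>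
      (⟨v.1, e.formsFiber V k v.1 v.2⟩ : (E'.formsTensor (V := V) k).Total)) := by
  apply continuous_total_of_local
  intro x₀
  refine ⟨fun x => ContinuousLinearMap.compContinuousAlternatingMapCLM (ι := Fin k) ℂ V
    E.model E'.model (e.rep x₀ x), ?_, ?_⟩
  · exact ContinuousAt.comp (f := e.rep x₀)
      (ContinuousLinearMap.compContinuousAlternatingMapCLM (ι := Fin k) ℂ V
        E.model E'.model).continuous.continuousAt (e.continuousAt_rep x₀)
  filter_upwards [base_mem_nhds E x₀, base_mem_nhds E' x₀] with x hx hx' v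
  have key (z : E.fiber x) :
      (trivializationAt E'.model E'.fiber x₀).linearMapAt ℂ x (e.fiberEquiv x z) =
        e.rep x₀ x ((trivializationAt E.model E.fiber x₀).linearMapAt ℂ x z) := by
    rw [Trivialization.coe_linearMapAt_of_mem _ hx, Trivialization.coe_linearMapAt_of_mem _ hx']
    exact (rep_trivialization e hx hx' _).symm
  exact ContinuousAlternatingMap.ext fun m => key _

/-- Isomorphic bundles have isomorphic bundles of `k`-forms. -/
def formsTensor (e : Iso E E') (k : ℕ) :
    Iso (E.formsTensor (V := V) k) (E'.formsTensor (V := V) k) where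
  fiberEquiv x := LinearEquiv.ofLinearMap (e.formsFiber V k x) (e.symm.formsFiber V k x)
    (LinearMap.ext fun _ => ContinuousAlternatingMap.ext fun _ =>
      (e.fiberEquiv x).apply_symm_apply _)
    (LinearMap.ext fun _ => ContinuousAlternatingMap.ext fun _ =>
      (e.fiberEquiv x).symm_apply_apply _)
  continuous_total := e.continuous_formsFiber k
  continuous_total_symm := e.symm.continuous_formsFiber k

end Iso

end Forms

end ComplexVectorBundle

/-! ## Isomorphism invariance of characteristic classes -/

namespace ComplexVectorBundle

open SingularCoh

variable {X : Type u} [TopologicalSpace X] {E E' : ComplexVectorBundle X}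
  {Y : Type u} [TopologicalSpace Y] {f : C(Y, X)}

namespace Iso

theorem continuousOn_section_map (e : Iso E E') {T : Type*} [TopologicalSpace T] {g : T → X}
    {s : ∀ t, E.fiber (g t)} {U : Set T}
    (hs : ContinuousOn (fun t => (⟨g t, s t⟩ : E.Total)) U) :
    ContinuousOn (fun t => (⟨g t, e.fiberEquiv (g t) (s t)⟩ : E'.Total)) U :=
  e.continuous_total.comp_continuousOn hs

/-- The image of a line subbundle under an isomorphism. -/
def mapLine (e : Iso E E') (L : LineSubbundle E f) : LineSubbundle E' f where
  line y := (L.line y).map (e.fiberEquiv (f y)).toLinearMap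
  finrank_line y := ((e.fiberEquiv (f y)).finrank_map_eq _).trans (L.finrank_line y)
  local_frame y₀ := by
    obtain ⟨U, hU, s, hs, hs'⟩ := L.local_frame y₀
    exact ⟨U, hU, fun y => e.fiberEquiv (f y) (s y), e.continuousOn_section_map hs, fun y hy =>
      ⟨Submodule.mem_map_of_mem (hs' y hy).1,
        (LinearEquiv.map_ne_zero_iff _).2 (hs' y hy).2⟩⟩

theorem isFrameAlong_mapLine (e : Iso E E') {L : LineSubbundle E f} {n : ℕ} {σ : C(Simplex n, Y)}
    {s : ∀ t, E.fiber (f (σ t))} (hs : L.IsFrameAlong σ s) :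
    (e.mapLine L).IsFrameAlong σ (fun t => e.fiberEquiv _ (s t)) :=
  ⟨e.continuous_total.comp hs.1, fun t =>
    ⟨Submodule.mem_map_of_mem (hs.2 t).1, (LinearEquiv.map_ne_zero_iff _).2 (hs.2 t).2⟩⟩

/-- Transport all frames by `e`. By linearity the scalar ratios of frames are unchanged, so the same
logarithms `φ` and the same winding numbers serve: the very cochain `c` is preserved, not just its
class. -/
theorem isFirstChernCocycle_mapLine (e : Iso E E') {L : LineSubbundle E f} {c : Cochain Y ℤ 2}
    (hc : L.IsFirstChernCocycle c) : (e.mapLine L).IsFirstChernCocycle c := by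
  obtain ⟨s₀, s₁, h₁, h₀, h₂⟩ := hc
  refine ⟨fun y => e.fiberEquiv _ (s₀ y), fun τ t => e.fiberEquiv _ (s₁ τ t),
    fun τ => e.isFrameAlong_mapLine (h₁ τ), fun τ a => congrArg (e.fiberEquiv _) (h₀ τ a),
    fun σ => ?_⟩
  obtain ⟨s₂, φ, hs, hφ, hcσ⟩ := h₂ σ
  exact ⟨fun t => e.fiberEquiv _ (s₂ t), φ, e.isFrameAlong_mapLine hs,
    fun j t => (congrArg (e.fiberEquiv _) (hφ j t)).trans (map_smul _ _ _), hcσ⟩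

/-- The image of a splitting under an isomorphism. -/
def mapSplitting (e : Iso E E') (h : E'.rank = E.rank) (S : E.Splitting f) : E'.Splitting f where
  summand j := e.mapLine (S.summand (Fin.cast h j))
  isInternal y := by
    have hS := S.isInternal y
    rw [DirectSum.isInternal_submodule_iff_iSupIndep_and_iSup_eq_top] at hS ⊢
    -- A linear equivalence is an isomorphism of subspace lattices, so it preserves independence and
    -- suprema.
    have hind := ((iSupIndep_map_orderIso_iff
      (Submodule.orderIsoMapComap (e.fiberEquiv (f y)))).2 hS.1).comp (Fin.cast_injective h)
    refine ⟨hind, ?_⟩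
    change (⨆ j, ((S.summand (finCongr h j)).line y).map (e.fiberEquiv (f y)).toLinearMap) = ⊤
    rw [(finCongr h).iSup_comp
      (g := fun j => ((S.summand j).line y).map (e.fiberEquiv (f y)).toLinearMap),
      ← Submodule.map_iSup, hS.2, Submodule.map_top, LinearEquiv.range]

end Iso

/-- Isomorphic bundles have only propositionally equal ranks, so their index types `Fin r` differ by
a cast. -/
theorem elemSymm_comp_cast {R : Type v} [CommRing R] {r r' : ℕ} (h : r' = r)
    (c : Fin r → Cochain Y R 2) (i : ℕ) : elemSymm (c ∘ Fin.cast h) i = elemSymm c i := by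
  subst h
  rfl

theorem expSum_comp_cast {r r' : ℕ} (h : r' = r) (c : Fin r → Cochain Y ℤ 2) (k : ℕ) :
    expSum (c ∘ Fin.cast h) k = expSum c k := by
  subst h
  rfl

namespace Iso

/-- A test splitting of `f^*E'` is carried back by `e.symm` to one of `f^*E`, with the same
cocycles, where the hypothesis applies. -/
theorem isChernClass [Nonempty X] (e : Iso E E') {i : ℕ} {γ : H X ℤ (2 * i)}
    (h : E.IsChernClass i γ) : E'.IsChernClass i γ := by
  intro Y _ f S c hc
  have key := h Y f (e.symm.mapSplitting e.rank_eq S) (c ∘ Fin.cast e.rank_eq)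
    (fun j => e.symm.isFirstChernCocycle_mapLine (hc _))
  rwa [elemSymm_comp_cast] at key

theorem isChernCharacter [Nonempty X] (e : Iso E E') {k : ℕ} {γ : H X ℚ (2 * k)}
    (h : E.IsChernCharacter k γ) : E'.IsChernCharacter k γ := by
  intro Y _ f S c hc
  have key := h Y f (e.symm.mapSplitting e.rank_eq S) (c ∘ Fin.cast e.rank_eq)
    (fun j => e.symm.isFirstChernCocycle_mapLine (hc _))
  rwa [expSum_comp_cast] at key

/-- Isomorphic bundles have the same Chern classes. -/
theorem chernClass_eq [Nonempty X] (e : Iso E E') (i : ℕ) : E.chernClass i = E'.chernClass i := by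
  -- Equal predicates have the same unique solution, or both take the default value `0`; neither
  -- existence nor uniqueness has to be known.
  have h : E.IsChernClass i = E'.IsChernClass i :=
    funext fun _ => propext ⟨e.isChernClass, e.symm.isChernClass⟩
  unfold chernClass
  rw [h]

/-- Isomorphic bundles have the same Chern character. -/
theorem chernCharacter_eq [Nonempty X] (e : Iso E E') : E.chernCharacter = E'.chernCharacter := by
  funext k
  have h : E.IsChernCharacter k = E'.IsChernCharacter k :=
    funext fun _ => propext ⟨e.isChernCharacter, e.symm.isChernCharacter⟩
  unfold chernCharacter
  rw [h]

end Iso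

end ComplexVectorBundle

/-! ## Uniqueness of the adjoint bundle -/

namespace PrincipalBundle

variable {EM EG G EP P : Type*} {M : Type u}
    [NormedAddCommGroup EM] [NormedSpace ℝ EM] [TopologicalSpace M] [ChartedSpace EM M]
    [NormedAddCommGroup EG] [NormedSpace ℝ EG] [TopologicalSpace G] [ChartedSpace EG G] [Group G]
    [NormedAddCommGroup EP] [NormedSpace ℝ EP] [TopologicalSpace P] [ChartedSpace EP P]

/-- `G` acts transitively on the fibres of a principal bundle. -/
theorem exists_act_eq (B : PrincipalBundle EM M EG G EP P) {p p' : P} (h : B.proj p = B.proj p') :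
    ∃ g, B.act p g = p' := by
  obtain ⟨U, -, hU, s, γ, -, -, -, hγ⟩ := B.locally_trivial (B.proj p)
  refine ⟨(γ p)⁻¹ * γ p', ?_⟩
  -- Both points are translates of the same `s(π(p))`, by `γ p` and `γ p'`.
  have h1 := hγ p hU
  have h2 := hγ p' (h ▸ hU)
  rw [← h] at h2
  calc B.act p ((γ p)⁻¹ * γ p')
      = B.act (B.act (s (B.proj p)) (γ p)) ((γ p)⁻¹ * γ p') := by rw [h1]
    _ = p' := by rw [← B.act_mul, mul_inv_cancel_left, h2]

theorem proj_pointOver (B : PrincipalBundle EM M EG G EP P) (x : M) :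
    B.proj (B.pointOver x) = x :=
  Function.surjInv_eq B.proj_surjective x

/-- A structure of complexified adjoint bundle `P ×_G (𝔤 ⊗ ℂ)` on `E`. -/
structure AdjointModel (B : PrincipalBundle EM M EG G EP P) (E : ComplexVectorBundle M) where
  /-- the isomorphism `X ↦ [p, X]` -/
  equiv : ∀ p : P, (ℂ ⊗[ℝ] GroupLieAlgebra 𝓘(ℝ, EG) G) ≃ₗ[ℂ] E.fiber (B.proj p)
  continuous_equiv : Continuous (fun a : P × GroupLieAlgebra 𝓘(ℝ, EG) G =>
    (⟨B.proj a.1, equiv a.1 (1 ⊗ₜ a.2)⟩ : E.Total))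
  equiv_act : ∀ (p : P) (g : G) (X : GroupLieAlgebra 𝓘(ℝ, EG) G),
    (⟨B.proj (B.act p g), equiv (B.act p g) (1 ⊗ₜ X)⟩ : E.Total) =
      ⟨B.proj p, equiv p (1 ⊗ₜ Ad g X)⟩

/-- The complexified adjoint representation. -/
def complexAd (g : G) : (ℂ ⊗[ℝ] GroupLieAlgebra 𝓘(ℝ, EG) G) →ₗ[ℂ]
    (ℂ ⊗[ℝ] GroupLieAlgebra 𝓘(ℝ, EG) G) :=
  LinearMap.baseChange ℂ ((mfderiv 𝓘(ℝ, EG) 𝓘(ℝ, EG) (fun x : G => g * x * g⁻¹) 1 :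
    EG →L[ℝ] EG).toLinearMap :
      GroupLieAlgebra 𝓘(ℝ, EG) G →ₗ[ℝ] GroupLieAlgebra 𝓘(ℝ, EG) G)

/-- A `ℂ`-linear map on `ℂ ⊗ W` is determined by the vectors `1 ⊗ X`. The comparison takes place in
the total space because `x` and `y`, hence their fibres, are only propositionally equal. -/
theorem total_mk_eq_of_tmul {W : Type*} [AddCommGroup W] [Module ℝ W] {E : ComplexVectorBundle M}
    {x y : M} (h : x = y) (φ : (ℂ ⊗[ℝ] W) →ₗ[ℂ] E.fiber x) (ψ : (ℂ ⊗[ℝ] W) →ₗ[ℂ] E.fiber y)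
    (H : ∀ X : W, (⟨x, φ (1 ⊗ₜ X)⟩ : E.Total) = ⟨y, ψ (1 ⊗ₜ X)⟩) (t : ℂ ⊗[ℝ] W) :
    (⟨x, φ t⟩ : E.Total) = ⟨y, ψ t⟩ := by
  subst h
  have h1 : φ = ψ := by
    refine LinearMap.ext fun t => ?_
    induction t with
    | zero => rw [map_zero, map_zero]
    | add a b ha hb => rw [map_add, map_add, ha, hb]
    | tmul z X =>
      have hz : z ⊗ₜ[ℝ] X = z • ((1 : ℂ) ⊗ₜ[ℝ] X) := by
        rw [TensorProduct.smul_tmul', smul_eq_mul, mul_one]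
      rw [hz, map_smul, map_smul, TotalSpace.mk_inj.1 (H X)]
  rw [h1]

/-- From `a = b ∘ A` and `a' = b' ∘ A` with a common `A`, one gets `a' ∘ a⁻¹ = b' ∘ b⁻¹`. With `A`
the complexified `Ad g`, this makes the transfer independent of the point of `P`. -/
theorem transfer_eq {W : Type*} [AddCommGroup W] [Module ℂ W] {E E' : ComplexVectorBundle M}
    {x y : M} (h : x = y) (a : W ≃ₗ[ℂ] E.fiber x) (a' : W ≃ₗ[ℂ] E'.fiber x)
    (b : W ≃ₗ[ℂ] E.fiber y) (b' : W ≃ₗ[ℂ] E'.fiber y) (A : W → W)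
    (H : ∀ t, (⟨x, a t⟩ : E.Total) = ⟨y, b (A t)⟩)
    (H' : ∀ t, (⟨x, a' t⟩ : E'.Total) = ⟨y, b' (A t)⟩) :
    h ▸ (a.symm.trans a') = b.symm.trans b' := by
  subst h
  refine LinearEquiv.ext fun v => ?_
  obtain ⟨t, rfl⟩ := a.surjective v
  change a' (a.symm (a t)) = b' (b.symm (a t))
  rw [LinearEquiv.symm_apply_apply, TotalSpace.mk_inj.1 (H t), LinearEquiv.symm_apply_apply,
    TotalSpace.mk_inj.1 (H' t)]

namespace AdjointModel

variable {B : PrincipalBundle EM M EG G EP P} {E E' : ComplexVectorBundle M}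

theorem equiv_act_complexAd (q : AdjointModel B E) (p : P) (g : G)
    (t : ℂ ⊗[ℝ] GroupLieAlgebra 𝓘(ℝ, EG) G) :
    (⟨B.proj (B.act p g), q.equiv (B.act p g) t⟩ : E.Total) =
      ⟨B.proj p, q.equiv p (complexAd g t)⟩ :=
  total_mk_eq_of_tmul (B.proj_act p g) (q.equiv (B.act p g)).toLinearMap
    ((q.equiv p).toLinearMap ∘ₗ complexAd g) (fun X => q.equiv_act p g X) t

/-- The isomorphism between the fibres at `π(p)` of two adjoint bundles, `[p, X] ↦ [p, X]`. -/
def transfer (q : AdjointModel B E) (q' : AdjointModel B E') {x : M} (p : P) (h : B.proj p = x) :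
    E.fiber x ≃ₗ[ℂ] E'.fiber x :=
  h ▸ ((q.equiv p).symm.trans (q'.equiv p))

theorem transfer_unique (q : AdjointModel B E) (q' : AdjointModel B E') {x : M} (p p' : P)
    (h : B.proj p = x) (h' : B.proj p' = x) : q.transfer q' p h = q.transfer q' p' h' := by
  obtain ⟨g, rfl⟩ := B.exists_act_eq (h'.trans h.symm)
  subst h'
  exact transfer_eq _ _ _ _ _ (complexAd g) (q.equiv_act_complexAd p' g)
    (q'.equiv_act_complexAd p' g)

/-- The isomorphism between the fibres of two adjoint bundles. -/
def fiberEquiv (q : AdjointModel B E) (q' : AdjointModel B E') (x : M) :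
    E.fiber x ≃ₗ[ℂ] E'.fiber x :=
  q.transfer q' (B.pointOver x) (B.proj_pointOver x)

/-- Independence of the chosen point allows `pointOver` to be replaced by any `p`; afterwards the
choice plays no role. -/
theorem fiberEquiv_equiv (q : AdjointModel B E) (q' : AdjointModel B E') (p : P)
    (t : ℂ ⊗[ℝ] GroupLieAlgebra 𝓘(ℝ, EG) G) :
    q.fiberEquiv q' (B.proj p) (q.equiv p t) = q'.equiv p t := by
  rw [fiberEquiv, transfer_unique q q' _ p _ rfl]
  change q'.equiv p ((q.equiv p).symm (q.equiv p t)) = _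
  rw [LinearEquiv.symm_apply_apply]

theorem fiberEquiv_symm (q : AdjointModel B E) (q' : AdjointModel B E') (x : M) :
    (q.fiberEquiv q' x).symm = q'.fiberEquiv q x := by
  obtain ⟨p, rfl⟩ := B.proj_surjective x
  refine LinearEquiv.ext fun v => ?_
  obtain ⟨t, rfl⟩ := (q'.equiv p).surjective v
  rw [LinearEquiv.symm_apply_eq, fiberEquiv_equiv, fiberEquiv_equiv]

/-! ### Frames of an adjoint bundle, and continuity of the transfer. -/

section Frames

variable {ι : Type*} [Finite ι] (b : Module.Basis ι ℝ (GroupLieAlgebra 𝓘(ℝ, EG) G))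

/-- The frame of an adjoint bundle at `π(p)` given by a basis of `𝔤`. -/
def frame (q : AdjointModel B E) (p : P) : (ι → ℂ) ≃ₗ[ℂ] E.fiber (B.proj p) :=
  (b.baseChange ℂ).equivFun.symm.trans (q.equiv p)

theorem frame_apply [Fintype ι] (q : AdjointModel B E) (p : P) (c : ι → ℂ) :
    q.frame b p c = ∑ i, c i • q.equiv p (1 ⊗ₜ b i) := by
  simp [frame, Module.Basis.equivFun_symm_apply]

/-- The frame at `π(p)` in the preferred trivialization at `x₀`. -/
def frameRep (q : AdjointModel B E) (x₀ : M) (p : P) : (ι → ℂ) →L[ℂ] E.model :=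
  LinearMap.toContinuousLinearMap
    (((trivializationAt E.model E.fiber x₀).linearMapAt ℂ (B.proj p)) ∘ₗ
      (q.frame b p).toLinearMap)

theorem frameRep_apply (q : AdjointModel B E) {x₀ : M} {p : P}
    (hp : B.proj p ∈ ComplexVectorBundle.Iso.base E x₀) (c : ι → ℂ) :
    q.frameRep b x₀ p c = (trivializationAt E.model E.fiber x₀ ⟨B.proj p, q.frame b p c⟩).2 := by
  change (trivializationAt E.model E.fiber x₀).linearMapAt ℂ (B.proj p) _ = _
  rw [Trivialization.coe_linearMapAt_of_mem _ hp]
  rfl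

/-- The frame in the preferred trivialization, as an isomorphism. -/
def frameRepEquiv (q : AdjointModel B E) {x₀ : M} {p : P}
    (hp : B.proj p ∈ ComplexVectorBundle.Iso.base E x₀) : (ι → ℂ) ≃L[ℂ] E.model :=
  ((q.frame b p).trans ((trivializationAt E.model E.fiber x₀).continuousLinearEquivAt ℂ
    (B.proj p) hp).toLinearEquiv).toContinuousLinearEquiv

theorem coe_frameRepEquiv (q : AdjointModel B E) {x₀ : M} {p : P}
    (hp : B.proj p ∈ ComplexVectorBundle.Iso.base E x₀) :
    (q.frameRepEquiv b hp : (ι → ℂ) →L[ℂ] E.model) = q.frameRep b x₀ p :=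
  ContinuousLinearMap.ext fun c => (q.frameRep_apply b hp c).symm

/-- Continuity of a model is given only on real vectors `1 ⊗ X`; a real basis of `𝔤` is a complex
basis of `ℂ ⊗ 𝔤`, so finite sums with complex coefficients reach everything. -/
theorem continuousAt_frameRep (q : AdjointModel B E) {x₀ : M} {p : P}
    (hp : B.proj p ∈ ComplexVectorBundle.Iso.base E x₀) :
    ContinuousAt (q.frameRep b x₀) p := by
  cases nonempty_fintype ι
  rw [continuousAt_clm_apply]
  intro c
  have h (i : ι) : ContinuousAt (fun p => (trivializationAt E.model E.fiber x₀
      ⟨B.proj p, q.equiv p (1 ⊗ₜ b i)⟩).2) p := by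
    have h1 : Continuous (fun p => (⟨B.proj p, q.equiv p (1 ⊗ₜ b i)⟩ : E.Total)) :=
      q.continuous_equiv.comp (by fun_prop : Continuous fun p : P => (p, b i))
    have h2 : ContinuousAt (trivializationAt E.model E.fiber x₀)
        ⟨B.proj p, q.equiv p (1 ⊗ₜ b i)⟩ :=
      (trivializationAt E.model E.fiber x₀).continuousAt (Trivialization.mem_source _ |>.2 hp)
    exact continuousAt_snd.comp (ContinuousAt.comp
      (f := fun p => (⟨B.proj p, q.equiv p (1 ⊗ₜ b i)⟩ : E.Total)) h2 h1.continuousAt)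
  have hsum : ContinuousAt (fun p => ∑ i, c i • (trivializationAt E.model E.fiber x₀
      ⟨B.proj p, q.equiv p (1 ⊗ₜ b i)⟩).2) p :=
    tendsto_finsetSum _ fun i _ => (h i).const_smul (c i)
  have hB : ∀ᶠ p' in 𝓝 p, B.proj p' ∈ ComplexVectorBundle.Iso.base E x₀ :=
    B.contMDiff_proj.continuous.continuousAt.eventually
      ((trivializationAt E.model E.fiber x₀).open_baseSet.mem_nhds hp)
  refine hsum.congr (hB.mono fun p' hp' => ?_)
  change _ = (trivializationAt E.model E.fiber x₀).linearMapAt ℂ (B.proj p') (q.frame b p' c)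
  rw [frame_apply, map_sum, Trivialization.coe_linearMapAt_of_mem _ hp']
  refine Finset.sum_congr rfl fun i _ => ?_
  have := map_smul ((trivializationAt E.model E.fiber x₀).linearMapAt ℂ (B.proj p')) (c i)
    (q.equiv p' (1 ⊗ₜ b i))
  rw [Trivialization.coe_linearMapAt_of_mem _ hp'] at this
  exact this.symm

end Frames

theorem continuous_fiberEquiv [FiniteDimensional ℝ EG] (q : AdjointModel B E)
    (q' : AdjointModel B E') :
    Continuous (fun v : E.Total => (⟨v.1, q.fiberEquiv q' v.1 v.2⟩ : E'.Total)) := by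
  have : FiniteDimensional ℝ (GroupLieAlgebra 𝓘(ℝ, EG) G) :=
    inferInstanceAs (FiniteDimensional ℝ EG)
  let b := Module.finBasis ℝ (GroupLieAlgebra 𝓘(ℝ, EG) G)
  apply ComplexVectorBundle.continuous_total_of_local (fun x => (q.fiberEquiv q' x).toLinearMap)
  intro x₀
  obtain ⟨U, hUo, hU, s, -, hs, -, hs', -⟩ := B.locally_trivial x₀
  have hsc : ContinuousAt s x₀ := hs.continuousOn.continuousAt (hUo.mem_nhds hU)
  have hx₀ : B.proj (s x₀) = x₀ := hs' x₀ hU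
  have hb : B.proj (s x₀) ∈ ComplexVectorBundle.Iso.base E x₀ := by
    rw [hx₀]; exact mem_baseSet_trivializationAt _ _ _
  have hb' : B.proj (s x₀) ∈ ComplexVectorBundle.Iso.base E' x₀ := by
    rw [hx₀]; exact mem_baseSet_trivializationAt _ _ _
  -- The transfer is (frame of `E'`) ∘ (frame of `E`)⁻¹ along the section `s`. `inverse` is total,
  -- with value `0` off the invertible maps, and is continuous at invertible ones.
  refine ⟨fun x => (q'.frameRep b x₀ (s x)).comp (q.frameRep b x₀ (s x)).inverse, ?_, ?_⟩
  · have h1 : ContinuousAt (fun x => q.frameRep b x₀ (s x)) x₀ :=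
      (q.continuousAt_frameRep b hb).comp hsc
    have h2 : ContinuousAt (fun x => q'.frameRep b x₀ (s x)) x₀ :=
      (q'.continuousAt_frameRep b hb').comp hsc
    have h3 : ContinuousAt ContinuousLinearMap.inverse (q.frameRep b x₀ (s x₀)) := by
      rw [← q.coe_frameRepEquiv b hb]
      exact (contDiffAt_map_inverse (𝕜 := ℂ) (n := 0) (q.frameRepEquiv b hb)).continuousAt
    exact h2.clm_comp (ContinuousAt.comp (f := fun x => q.frameRep b x₀ (s x)) h3 h1)
  · filter_upwards [ComplexVectorBundle.Iso.base_mem_nhds E x₀,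
      ComplexVectorBundle.Iso.base_mem_nhds E' x₀, hUo.mem_nhds hU] with x hx hx' hxU
    -- `B.proj (s x) = x` is not definitional; with a free `y` it can be substituted away.
    have key : ∀ y, B.proj (s x) = y → y ∈ ComplexVectorBundle.Iso.base E x₀ →
        y ∈ ComplexVectorBundle.Iso.base E' x₀ → ∀ v : E.fiber y,
        (trivializationAt E'.model E'.fiber x₀ ⟨y, q.fiberEquiv q' y v⟩).2 =
          q'.frameRep b x₀ (s x) ((q.frameRep b x₀ (s x)).inverse
            (trivializationAt E.model E.fiber x₀ ⟨y, v⟩).2) := by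
      rintro _ rfl hy hy' v
      obtain ⟨c, rfl⟩ := (q.frame b (s x)).surjective v
      rw [← q.frameRep_apply b hy, ← q.coe_frameRepEquiv b hy, ContinuousLinearMap.inverse_equiv,
        ContinuousLinearEquiv.coe_coe, ContinuousLinearEquiv.coe_coe,
        ContinuousLinearEquiv.symm_apply_apply, q'.frameRep_apply b hy']
      exact congrArg (fun w => (trivializationAt E'.model E'.fiber x₀ ⟨B.proj (s x), w⟩).2)
        (q.fiberEquiv_equiv q' (s x) _)
    exact key x (hs' x hxU) hx hx'

/-- Any two models of the adjoint bundle are isomorphic. -/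
def iso [FiniteDimensional ℝ EG] (q : AdjointModel B E) (q' : AdjointModel B E') :
    ComplexVectorBundle.Iso E E' where
  fiberEquiv := q.fiberEquiv q'
  continuous_total := q.continuous_fiberEquiv q'
  continuous_total_symm := by
    simp only [fiberEquiv_symm]
    exact q'.continuous_fiberEquiv q

end AdjointModel

theorem IsAdjointBundle.nonempty_iso [FiniteDimensional ℝ EG] {B : PrincipalBundle EM M EG G EP P}
    {E E' : ComplexVectorBundle M} (hE : B.IsAdjointBundle E) (hE' : B.IsAdjointBundle E') :
    Nonempty (ComplexVectorBundle.Iso E E') := by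
  obtain ⟨q, h₁, h₂⟩ := hE
  obtain ⟨q', h₁', h₂'⟩ := hE'
  exact ⟨AdjointModel.iso ⟨q, h₁, h₂⟩ ⟨q', h₁', h₂'⟩⟩

end PrincipalBundle

/-! ## The mirror of a compatible pair -/

section Mirror

/-- `fderiv_neg` holds without differentiability, so no regularity of `α` is required. -/
theorem extDerivOneForm_neg {EP P W : Type*} [NormedAddCommGroup EP] [NormedSpace ℝ EP]
    [TopologicalSpace P] [ChartedSpace EP P] [NormedAddCommGroup W] [NormedSpace ℝ W]
    (α : ∀ p : P, TangentSpace 𝓘(ℝ, EP) p →L[ℝ] W) (p : P) :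
    extDerivOneForm (-α) p = -extDerivOneForm α p := by
  let χ := extChartAt 𝓘(ℝ, EP) p
  let β : EP → EP →L[ℝ] W := fun y =>
    (α (χ.symm y)).comp (mfderiv 𝓘(ℝ, EP) 𝓘(ℝ, EP) χ.symm y)
  let β' : EP → EP →L[ℝ] W := fun y =>
    ((-α) (χ.symm y)).comp (mfderiv 𝓘(ℝ, EP) 𝓘(ℝ, EP) χ.symm y)
  have hβ : β' = -β := funext fun y => ContinuousLinearMap.neg_comp _ _
  have h : fderiv ℝ β' (χ p) - (fderiv ℝ β' (χ p)).flip =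
      -(fderiv ℝ β (χ p) - (fderiv ℝ β (χ p)).flip) := by
    rw [hβ, fderiv_neg]
    refine ContinuousLinearMap.ext fun u => ContinuousLinearMap.ext fun v => ?_
    change -(fderiv ℝ β (χ p) u v) - -(fderiv ℝ β (χ p) v u) =
      -(fderiv ℝ β (χ p) u v - fderiv ℝ β (χ p) v u)
    abel
  exact h

theorem OneFormContMDiff.neg {EP P W : Type*} [NormedAddCommGroup EP] [NormedSpace ℝ EP]
    [TopologicalSpace P] [ChartedSpace EP P] [NormedAddCommGroup W] [NormedSpace ℝ W]
    [IsManifold 𝓘(ℝ, EP) ∞ P] {n : ℕ∞ω} {α : ∀ p : P, TangentSpace 𝓘(ℝ, EP) p →L[ℝ] W}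
    (h : OneFormContMDiff n α) : OneFormContMDiff n (-α) :=
  contDiff_neg.contMDiff.comp h

namespace PrincipalBundle

variable {EM M EG G EP P : Type*}
    [NormedAddCommGroup EM] [NormedSpace ℝ EM] [TopologicalSpace M] [ChartedSpace EM M]
    [NormedAddCommGroup EG] [NormedSpace ℝ EG] [TopologicalSpace G] [ChartedSpace EG G] [Group G]
    [NormedAddCommGroup EP] [NormedSpace ℝ EP] [TopologicalSpace P] [ChartedSpace EP P]
    {B : PrincipalBundle EM M EG G EP P} {w : ∀ p : P, TangentSpace 𝓘(ℝ, EP) p →L[ℝ] EG}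
    {D : ∀ p : P, Submodule ℝ (TangentSpace 𝓘(ℝ, EP) p)}
    {lam : ∀ p : P, TangentSpace 𝓘(ℝ, EP) p →L[ℝ] (EG →L[ℝ] ℝ)}

/-- If `(D, lam)` is a compatible pair, so is `(D, -lam)`. -/
theorem IsCompatiblePair.neg [IsManifold 𝓘(ℝ, EP) ∞ P] (h : B.IsCompatiblePair w D lam) :
    B.IsCompatiblePair w D (-lam) where
  contMDiff := h.contMDiff.neg
  sup_vertical := h.sup_vertical
  inf_vertical := h.inf_vertical
  cartan p u v Z := by
    have hc := h.cartan p u v Z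
    rw [extDerivOneForm_neg]
    change -(extDerivOneForm lam p u v Z) - -(lam p v (lieBr G (w p u) Z)) +
      -(lam p u (lieBr G (w p v) Z)) = 0
    linarith
  compatible p v := (h.compatible p v).trans (forall_congr' fun _ => neg_eq_zero.symm)
  equivariant_D := h.equivariant_D
  equivariant_lam p g u Z := congrArg Neg.neg (h.equivariant_lam p g u Z)

/-- The constraint strength metric is invariant under `lam ↦ -lam`. -/
theorem spencerMetricA_neg [MeasurableSpace M] (S : B.SpencerMetricData)
    (lam : ∀ p : P, TangentSpace 𝓘(ℝ, EP) p →L[ℝ] (EG →L[ℝ] ℝ)) (k : ℕ)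
    (u₁ u₂ : B.SpencerField k) :
    spencerMetricA S (-lam) k u₁ u₂ = spencerMetricA S lam k u₁ u₂ := by
  have h (p : P) : S.normForm p ((-lam) p) = S.normForm p (lam p) :=
    map_neg_eq_map (S.normForm p) (lam p)
  simp only [spencerMetricA, h]

end PrincipalBundle

end Mirror

end

theorem mainTheorem2
    -- `M` is a compact connected complex manifold, modelled on `V`
    {V M : Type u} [NormedAddCommGroup V] [NormedSpace ℂ V] [FiniteDimensional ℂ V]
    [TopologicalSpace M] [ChartedSpace V M] [IsManifold 𝓘(ℂ, V) ω M]
    [T2Space M] [CompactSpace M] [ConnectedSpace M] [MeasurableSpace M] [BorelSpace M]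
    -- `G` is a compact connected semisimple Lie group with trivial center
    {EG G : Type*} [NormedAddCommGroup EG] [NormedSpace ℝ EG] [FiniteDimensional ℝ EG]
    [CompleteSpace EG] [TopologicalSpace G] [ChartedSpace EG G] [Group G] [LieGroup 𝓘(ℝ, EG) ∞ G]
    [T2Space G] [CompactSpace G] [ConnectedSpace G]
    [LieAlgebra.IsSemisimple ℝ (GroupLieAlgebra 𝓘(ℝ, EG) G)]
    (_hcenter : Subgroup.center G = ⊥)
    -- `B : P → M` is a smooth principal `G`-bundle with connection form `w`
    {EP P : Type*} [NormedAddCommGroup EP] [NormedSpace ℝ EP] [FiniteDimensional ℝ EP]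
    [TopologicalSpace P] [ChartedSpace EP P] [IsManifold 𝓘(ℝ, EP) ∞ P]
    (B : PrincipalBundle V M EG G EP P)
    (w : ∀ p : P, TangentSpace 𝓘(ℝ, EP) p →L[ℝ] EG) (_hw : B.IsConnection w)
    -- `(D, lam)` is a compatible pair
    (D : ∀ p : P, Submodule ℝ (TangentSpace 𝓘(ℝ, EP) p))
    (lam : ∀ p : P, TangentSpace 𝓘(ℝ, EP) p →L[ℝ] (EG →L[ℝ] ℝ))
    (_hpair : B.IsCompatiblePair w D lam) :
    -- the mirror `(D, -lam)` is again a compatible pair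
    B.IsCompatiblePair w D (-lam) ∧
    -- mirror invariance of the two Spencer metrics
    (∀ (S : B.SpencerMetricData) (k : ℕ) (u₁ u₂ : B.SpencerField k),
      PrincipalBundle.spencerMetricA S (-lam) k u₁ u₂ =
          PrincipalBundle.spencerMetricA S lam k u₁ u₂ ∧
        PrincipalBundle.spencerMetricB S w (-lam) k u₁ u₂ =
          PrincipalBundle.spencerMetricB S w lam k u₁ u₂) ∧
    -- for the adjoint bundles `E` of `(D, lam)` and `E'` of `(D, -lam)`, all classes agree
    (∀ E E' : ComplexVectorBundle M, B.IsAdjointBundle E → B.IsAdjointBundle E' →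
      (∀ i, E.chernClass i = E'.chernClass i) ∧
      E.chernCharacter = E'.chernCharacter ∧
      (∀ k, (E.symPow k).chernCharacter = (E'.symPow k).chernCharacter) ∧
      ∀ k, ((E.symPow k).formsTensor (V := V) k).chernCharacter =
        ((E'.symPow k).formsTensor (V := V) k).chernCharacter) := by
  -- The curvature depends on `w` alone, so the second metric is unchanged by definition.
  refine ⟨_hpair.neg, fun S k u₁ u₂ => ⟨PrincipalBundle.spencerMetricA_neg S lam k u₁ u₂, rfl⟩,
    fun E E' hE hE' => ?_⟩
  obtain ⟨e⟩ := hE.nonempty_iso hE'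
  exact ⟨e.chernClass_eq, e.chernCharacter_eq, fun k => (e.symPow k).chernCharacter_eq,
    fun k => ((e.symPow k).formsTensor k).chernCharacter_eq⟩
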